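/- Let $\mathcal{L}$ be a countable first-order language, $T$ a complete $\mathcal{L}$-theory and $\mathcal{U}$ a monster model of $T$; that is, $\mathcal{U}\models T$ is $\kappa$-saturated for some uncountable cardinal $\kappa$ (every complete type in one variable over fewer than $\kappa$ parameters from $\mathcal{U}$ is realized in $\mathcal{U}$), and *small* means of cardinality less than $\kappa$. Let $x=(x_0,\dots,x_{n-1})$ be a finite tuple of variables, let $S_x(\mathcal{U})$ be the space of complete types in $x$ over $\mathcal{U}$ with the Stone topology, and let $p\in S_x(\mathcal{U})$. Let $M\prec\mathcal{U}$ be a small elementary submodel. The type $p$ is *invariant over $M$* if for every $\mathcal{L}$-formula $\varphi(x,y)$ and all $b,b'\in\mathcal{U}^y$ with $\operatorname{tp}(b/M)=\operatorname{tp}(b'/M)$ one has $\varphi(x,b)\in p\iff\varphi(x,b')\in p$. A *Morley sequence in $p$ over $M$* is a sequence $(a_i)_{i\in\omega}$ in $\mathcal{U}^x$ such that, for every $i$, $a_i$ satisfies all formulas of $p$ with parameters in $M\cup\{a_j: j<i\}$. The type $p$ is *generically stable over $M$* if it is invariant over $M$ and $\lim_{i\to\infty}\operatorname{tp}(a_i/\mathcal{U})=p$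 in $S_x(\mathcal{U})$ for every Morley sequence $(a_i)_{i\in\omega}$ in $p$ over $M$. The type $p$ is *sequentially approximated over $M$* if there is a sequence $(a_i)_{i\in\omega}$ in $M^x$ such that $\lim_{i\to\infty}\operatorname{tp}(a_i/\mathcal{U})=p$ in $S_x(\mathcal{U})$. Finally, $p$ is *generically stable* (respectively *sequentially approximated*) if it is so over some small $M\prec\mathcal{U}$. **Theorem.** For every small $M\prec\mathcal{U}$, if $p$ is generically stable over $M$, then $p$ is sequentially approximated over $M$. In particular, if $p$ is generically stable, then $p$ is sequentially approximated. -/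

import Mathlib

open FirstOrder FirstOrder.Language Cardinal Filter Topology

universe u v w

namespace GenStable

variable {L : FirstOrder.Language.{u, v}} {U : Type w} [L.Structure U]

/-- For a set `A` of parameters in `U`, the space `S_x(A)` of complete types over `A` in the
variables `x = (x_0, …, x_{n-1})`. It carries Mathlib's Stone topology. -/
abbrev TypeOver (L : FirstOrder.Language.{u, v}) {U : Type w} [L.Structure U] (A : Set U) (n : ℕ) :=
  Theory.CompleteType (L[[A]].completeTheory U) (Fin n)

/-- The space `S_x(U)` of global complete types in the variables `x = (x_0, …, x_{n-1})`,
with the Stone topology. -/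
abbrev GlobalType (L : FirstOrder.Language.{u, v}) (U : Type w) [L.Structure U] (n : ℕ) :=
  Theory.CompleteType (L.elementaryDiagram U) (Fin n)

/-- `tp(a/A)`. -/
abbrev tp (L : FirstOrder.Language.{u, v}) {U : Type w} [L.Structure U] [Nonempty U] (A : Set U) {n : ℕ}
    (a : Fin n → U) : TypeOver L A n :=
  (L[[A]].completeTheory U).typeOf a

/-- `tp(a/U)`. -/
abbrev globalTp (L : FirstOrder.Language.{u, v}) {U : Type w} [L.Structure U] [Nonempty U] {n : ℕ}
    (a : Fin n → U) : GlobalType L U n :=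
  (L.elementaryDiagram U).typeOf a

/-- The formula `ψ(x)` with parameters in `U` belongs to the global type `p`. -/
def Holds {n : ℕ} (p : GlobalType L U n) (ψ : L[[U]].Formula (Fin n)) : Prop :=
  Formula.equivSentence ψ ∈ p

/-- For a partitioned `L`-formula `φ(x, y)` and a tuple `b` in `U^y`, the formula `φ(x, b)`. -/
def instantiate {n m : ℕ} (φ : L.Formula (Fin n ⊕ Fin m)) (b : Fin m → U) :
    L[[U]].Formula (Fin n) :=
  ((L.lhomWithConstants U).onFormula φ).subst
    (Sum.elim Term.var fun j => Constants.term (L.con (b j)))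

theorem realize_instantiate {n m : ℕ} (φ : L.Formula (Fin n ⊕ Fin m)) (b : Fin m → U)
    (a : Fin n → U) : (instantiate φ b).Realize a ↔ φ.Realize (Sum.elim a b) := by
  unfold instantiate Formula.Realize
  rw [BoundedFormula.realize_subst,
    show (L.lhomWithConstants U).onFormula φ = (L.lhomWithConstants U).onBoundedFormula φ from rfl,
    LHom.realize_onBoundedFormula]
  refine iff_of_eq (congrArg (fun f => BoundedFormula.Realize φ f default) ?_)
  funext i
  cases i <;> simp [Term.realize_constants]
  · rfl

/-- `U` is `κ`-saturated: every complete 1-type over fewer than `κ` parameters is realized. -/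
def IsSaturated (L : FirstOrder.Language.{u, v}) (U : Type w) [L.Structure U] [Nonempty U]
    (κ : Cardinal.{w}) : Prop :=
  ∀ A : Set U, #A < κ → ∀ q : TypeOver L A 1, ∃ a : Fin 1 → U, tp L A a = q

/-- `p` is invariant over `A`: if `b ≡_A b'` then `φ(x, b) ∈ p ↔ φ(x, b') ∈ p`. -/
def IsInvariantOver [Nonempty U] {n : ℕ} (p : GlobalType L U n) (A : Set U) : Prop :=
  ∀ (m : ℕ) (φ : L.Formula (Fin n ⊕ Fin m)) (b b' : Fin m → U),
    tp L A b = tp L A b' → (Holds p (instantiate φ b) ↔ Holds p (instantiate φ b'))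

/-- `a ⊨ p|_A`: the tuple `a` satisfies every formula of `p` whose parameters lie in `A`. -/
def RealizesRestriction {n : ℕ} (p : GlobalType L U n) (A : Set U) (a : Fin n → U) : Prop :=
  ∀ φ : L[[A]].Formula (Fin n),
    Holds p ((L.lhomWithConstantsMap (Subtype.val : A → U)).onFormula φ) → φ.Realize a

/-- `(a_i)` is a Morley sequence in `p` over `A`: `a_i ⊨ p|_{A ∪ {a_j : j < i}}` for all `i`. -/
def IsMorleySequence {n : ℕ} (p : GlobalType L U n) (A : Set U) (a : ℕ → Fin n → U) : Prop :=
  ∀ i, RealizesRestriction p (A ∪ ⋃ j < i, Set.range (a j)) (a i)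

/-- `p` is generically stable over `M`. -/
def IsGenericallyStableOver [Nonempty U] {n : ℕ} (p : GlobalType L U n)
    (M : L.ElementarySubstructure U) : Prop :=
  IsInvariantOver p (M : Set U) ∧
    ∀ a : ℕ → Fin n → U, IsMorleySequence p (M : Set U) a →
      Tendsto (fun i => globalTp L (a i)) atTop (𝓝 p)

/-- `p` is sequentially approximated over `M`. -/
def IsSeqApproximatedOver [Nonempty U] {n : ℕ} (p : GlobalType L U n)
    (M : L.ElementarySubstructure U) : Prop :=
  ∃ a : ℕ → Fin n → U, (∀ i k, a i k ∈ M) ∧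
    Tendsto (fun i => globalTp L (a i)) atTop (𝓝 p)

/-- `p` is generically stable, where small means of cardinality less than `κ`. -/
def IsGenericallyStable [Nonempty U] {n : ℕ} (κ : Cardinal.{w}) (p : GlobalType L U n) : Prop :=
  ∃ M : L.ElementarySubstructure U, #M < κ ∧ IsGenericallyStableOver p M

/-- `p` is sequentially approximated, where small means of cardinality less than `κ`. -/
def IsSeqApproximated [Nonempty U] {n : ℕ} (κ : Cardinal.{w}) (p : GlobalType L U n) : Prop :=
  ∃ M : L.ElementarySubstructure U, #M < κ ∧ IsSeqApproximatedOver p M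

end GenStable

namespace GenStable

variable {L : FirstOrder.Language.{u, v}} {U : Type w} [L.Structure U]

/-! Let `a` be a Morley sequence in `p` over `M`. If for each `N` and each `M`-definable `Θ`
satisfied by `a_0, …, a_{N-1}` some `b` made `φ(x, b)` fail on one `N`-tuple of `Θ` and hold on
another, saturation would give two Morley sequences and one `b` with `φ(x, b)` false along the first
and true along the second. Both sequences converge to `p`, which is absurd. So some `Θ_φ`, for
tuples of length `N_φ`, separates (`exists_separating`).

Hence `φ(x, b) ∈ p` iff `φ(x, b)` holds on all entries of some element of `Θ_φ`, so `p` is definable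
over `M` (`definable_setOf_large`). Quantifying variables out of `Θ_φ` one at a time by "for
`p`-most `x`" then gives `M`-definable conditions on shorter tuples
(`IsMorleySequence.exists_tower`).

By countability, enumerate the formulas. Choose `c_i` in `M` recursively so that it extends every
tuple of earlier terms satisfying one of the first `i + 1` towers; this is a finite intersection of
`M`-definable sets in `p`, so elementarity applies (`exists_seq_mem_tower`). Every late subsequence
of `c` then starts in `Θ_φ`. If `φ(x, b) ∈ p` failed infinitely often along `c`, a subsequence of
failures and a Morley sequence over `M` and `b` would contradict separation. -/

instance lhomWithConstantsMap_val_isExpansionOn (A : Set U) :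
    (L.lhomWithConstantsMap (Subtype.val : A → U)).IsExpansionOn U :=
  have : (LHom.constantsOnMap (Subtype.val : A → U)).IsExpansionOn U :=
    constantsOnMap_isExpansionOn rfl
  LHom.sumMap_isExpansionOn _ _ _

/-- The sentence `∀ x, ψ → χ` lies in the elementary diagram, hence holds in any model realizing
`p`. Membership in `p` thus depends only on the subset of `U^n` defined, which justifies working
with `Large`. -/
theorem holds_of_imp [Nonempty U] {n : ℕ} (p : GlobalType L U n) {ψ χ : L[[U]].Formula (Fin n)}
    (h : ∀ a : Fin n → U, ψ.Realize a → χ.Realize a) (hψ : Holds p ψ) : Holds p χ := by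
  obtain ⟨N, v, rfl⟩ := Theory.exists_modelType_is_realized_in (L.elementaryDiagram U) p
  unfold Holds at *
  rw [Theory.CompleteType.formula_mem_typeOf] at *
  let σ : L[[U]].Sentence := Formula.iAlls (Fin n) (((ψ.imp χ).relabel Sum.inr :
    L[[U]].Formula (Empty ⊕ Fin n)))
  have hσ : σ ∈ L.elementaryDiagram U := by
    change U ⊨ σ
    simp only [σ, Sentence.Realize, Formula.realize_iAlls, Formula.realize_relabel]
    intro a
    simpa using h _
  have hN : N ⊨ σ := N.is_model.realize_of_mem _ hσ
  simp only [σ, Sentence.Realize, Formula.realize_iAlls, Formula.realize_relabel] at hN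
  have := hN v
  rw [Formula.realize_imp] at this
  exact this hψ

theorem holds_not {n : ℕ} (p : GlobalType L U n) {ψ : L[[U]].Formula (Fin n)} :
    Holds p ψ.not ↔ ¬ Holds p ψ :=
  Theory.CompleteType.not_mem_iff p (Formula.equivSentence ψ)

theorem holds_inf {n : ℕ} (p : GlobalType L U n) {ψ χ : L[[U]].Formula (Fin n)}
    (hψ : Holds p ψ) (hχ : Holds p χ) : Holds p (ψ ⊓ χ) := by
  obtain ⟨N, v, rfl⟩ := Theory.exists_modelType_is_realized_in (L.elementaryDiagram U) p
  unfold Holds at *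
  rw [Theory.CompleteType.formula_mem_typeOf] at *
  exact Formula.realize_inf.2 ⟨hψ, hχ⟩

/-- The set `D` of `n`-tuples is defined by a formula of the global type `p`. -/
def Large {n : ℕ} (p : GlobalType L U n) (D : Set (Fin n → U)) : Prop :=
  ∃ ψ : L[[U]].Formula (Fin n), (∀ a, ψ.Realize a ↔ a ∈ D) ∧ Holds p ψ

/-! ### Global types as ultrafilters of definable sets -/

section Large

variable {n : ℕ} {p : GlobalType L U n} {D E : Set (Fin n → U)} {A : Set U}

theorem large_iff_holds [Nonempty U] {ψ : L[[U]].Formula (Fin n)} (h : ∀ a, ψ.Realize a ↔ a ∈ D) :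
    Large p D ↔ Holds p ψ :=
  ⟨fun ⟨_, hχ, hp⟩ => holds_of_imp p (fun a ha => (h a).2 ((hχ a).1 ha)) hp, fun hp => ⟨ψ, h, hp⟩⟩

theorem exists_formula_of_definable (h : A.Definable L D) :
    ∃ φ : L[[A]].Formula (Fin n), (∀ a, φ.Realize a ↔ a ∈ D) ∧
      ∀ a, ((L.lhomWithConstantsMap (Subtype.val : A → U)).onFormula φ).Realize a ↔ a ∈ D := by
  obtain ⟨φ, rfl⟩ := h
  exact ⟨φ, fun a => Iff.rfl, fun a => LHom.realize_onFormula _ _⟩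

theorem Large.nonempty [Nonempty U] (h : Large p D) : D.Nonempty := by
  obtain ⟨ψ, hψ, hp⟩ := h
  by_contra hD
  have h0 : ∀ a, ¬ ψ.Realize a := fun a ha => hD ⟨a, (hψ a).1 ha⟩
  have : Holds p ψ.not := holds_of_imp p (fun a ha => absurd ha (h0 a)) hp
  exact (holds_not p).1 this hp

theorem Large.inter (hD : Large p D) (hE : Large p E) : Large p (D ∩ E) := by
  obtain ⟨ψ, hψ, hp⟩ := hD
  obtain ⟨χ, hχ, hq⟩ := hE
  exact ⟨ψ ⊓ χ, fun a => by rw [Formula.realize_inf, hψ, hχ]; rfl, holds_inf p hp hq⟩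

theorem large_univ [Nonempty U] : Large p (Set.univ : Set (Fin n → U)) := by
  by_contra h
  rw [large_iff_holds (ψ := ⊤) (fun a => by simp), ← holds_not] at h
  obtain ⟨a, ha⟩ := Large.nonempty (p := p)
    (D := {a | (⊤ : L[[U]].Formula (Fin n)).not.Realize a}) ⟨_, fun a => Iff.rfl, h⟩
  simp at ha

theorem large_compl [Nonempty U] (hD : A.Definable L D) : Large p Dᶜ ↔ ¬ Large p D := by
  obtain ⟨φ, -, h⟩ := exists_formula_of_definable hD
  rw [large_iff_holds h, ← holds_not]
  exact large_iff_holds fun a => by simp [h]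

theorem large_iInter [Nonempty U] {ι : Type*} [Finite ι] {F : ι → Set (Fin n → U)} (h : ∀ i, Large p (F i)) :
    Large p (⋂ i, F i) := by
  classical
  have := Fintype.ofFinite ι
  have key : ∀ s : Finset ι, Large p (⋂ i ∈ s, F i) := by
    intro s
    induction s using Finset.induction with
    | empty => simpa using large_univ
    | insert i s _ ih => rw [Finset.set_biInter_insert]; exact (h i).inter ih
  simpa using key Finset.univ

theorem realizesRestriction_iff [Nonempty U] {a : Fin n → U} :
    RealizesRestriction p A a ↔ ∀ D, A.Definable L D → Large p D → a ∈ D := by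
  constructor
  · intro h D hD hp
    obtain ⟨φ, h1, h2⟩ := exists_formula_of_definable hD
    exact (h1 a).1 (h φ ((large_iff_holds h2).1 hp))
  · intro h φ hp
    exact h {a | φ.Realize a} ⟨φ, rfl⟩ ⟨_, fun a => LHom.realize_onFormula _ _, hp⟩

theorem RealizesRestriction.mem_iff [Nonempty U] {a : Fin n → U} (h : RealizesRestriction p A a)
    (hD : A.Definable L D) : a ∈ D ↔ Large p D := by
  rw [realizesRestriction_iff] at h
  refine ⟨fun ha => ?_, h D hD⟩
  by_contra hp
  exact h _ hD.compl ((large_compl hD).2 hp) ha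

theorem RealizesRestriction.mono [Nonempty U] {a : Fin n → U} {B : Set U} (h : RealizesRestriction p B a)
    (hAB : A ⊆ B) : RealizesRestriction p A a := by
  rw [realizesRestriction_iff] at *
  exact fun D hD => h D (hD.mono hAB)

theorem IsMorleySequence.mono [Nonempty U] {a : ℕ → Fin n → U} {B : Set U} (h : IsMorleySequence p B a)
    (hAB : A ⊆ B) : IsMorleySequence p A a :=
  fun i => (h i).mono (Set.union_subset_union_left _ hAB)

theorem tendsto_globalTp_iff [Nonempty U] {a : ℕ → Fin n → U} :
    Tendsto (fun i => globalTp L (a i)) atTop (𝓝 p) ↔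
      ∀ ψ : L[[U]].Formula (Fin n), Holds p ψ → ∀ᶠ i in atTop, ψ.Realize (a i) := by
  rw [TopologicalSpace.tendsto_nhds_generateFrom_iff]
  constructor
  · intro h ψ hψ
    filter_upwards [h _ ⟨Formula.equivSentence ψ, rfl⟩ hψ] with i hi
    exact (Theory.CompleteType.formula_mem_typeOf (T := L.elementaryDiagram U)).1 hi
  · rintro h _ ⟨φ, rfl⟩ hφ
    filter_upwards [h (Formula.equivSentence.symm φ) (by simpa [Holds] using hφ)] with i hi
    exact (Theory.CompleteType.mem_typeOf (T := L.elementaryDiagram U)).2 hi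

theorem eventually_mem_of_tendsto [Nonempty U] {a : ℕ → Fin n → U}
    (h : Tendsto (fun i => globalTp L (a i)) atTop (𝓝 p)) (hp : Large p D) :
    ∀ᶠ i in atTop, a i ∈ D := by
  obtain ⟨ψ, hψ, hp⟩ := hp
  filter_upwards [tendsto_globalTp_iff.1 h ψ hp] with i hi using (hψ _).1 hi

end Large

/-! ### Changing parameters and variables of definable sets -/

section Definable

variable {A : Set U} {α β γ : Type}

theorem definable_preimage_params {E : Set (γ → U)} (hE : A.Definable L E) (h : γ → A ⊕ β) :
    A.Definable L {w : β → U | (fun k => Sum.elim (Subtype.val : A → U) w (h k)) ∈ E} := by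
  rw [Set.definable_iff_exists_formula_sum] at *
  obtain ⟨φ, rfl⟩ := hE
  refine ⟨φ.relabel (Sum.elim Sum.inl h), ?_⟩
  ext w
  change φ.Realize _ ↔ Formula.Realize (φ.relabel _) _
  rw [Formula.realize_relabel]
  refine iff_of_eq (congrArg _ ?_)
  funext i
  cases i <;> rfl

theorem definable_fiber {E : Set (α ⊕ β → U)} (hE : A.Definable L E) (b : β → U) :
    (A ∪ Set.range b).Definable L {x : α → U | Sum.elim x b ∈ E} := by
  have := definable_preimage_params (hE.mono (Set.subset_union_left (t := Set.range b)))
    (Sum.elim Sum.inr fun j => Sum.inl ⟨b j, Or.inr ⟨j, rfl⟩⟩ : α ⊕ β → ↥(A ∪ Set.range b) ⊕ α)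
  convert this using 4 with x
  funext i
  cases i <;> rfl

/-- Each parameter outside `A` becomes a variable, at a chosen index where `b` takes that value. -/
theorem exists_definable_fiber {D : Set (α → U)} {b : β → U}
    (hD : (A ∪ Set.range b).Definable L D) :
    ∃ E : Set (α ⊕ β → U), A.Definable L E ∧ ∀ x, x ∈ D ↔ Sum.elim x b ∈ E := by
  classical
  obtain ⟨φ, rfl⟩ := Set.definable_iff_exists_formula_sum.1 hD
  let h : ↥(A ∪ Set.range b) ⊕ α → A ⊕ (α ⊕ β) := Sum.elim
    (fun c => if hc : (c : U) ∈ A then Sum.inl ⟨c, hc⟩ else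
      Sum.inr (Sum.inr (c.2.resolve_left hc).choose)) (Sum.inr ∘ Sum.inl)
  refine ⟨_, Set.definable_iff_exists_formula_sum.2 ⟨φ.relabel h, rfl⟩, fun x => ?_⟩
  change φ.Realize _ ↔ Formula.Realize (φ.relabel _) _
  rw [Formula.realize_relabel]
  refine iff_of_eq (congrArg _ ?_)
  funext i
  rcases i with c | j
  · by_cases hc : (c : U) ∈ A
    · simp [h, hc]
    · simpa [h, hc] using (c.2.resolve_left hc).choose_spec.symm
  · simp [h]

theorem exists_finset_support {α : Type*} {D : Set (α → U)} (hD : A.Definable L D) :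
    ∃ s : Finset α, ∀ {δ : Type} (g : δ → α), (∀ x ∈ s, x ∈ Set.range g) →
      ∃ E : Set (δ → U), A.Definable L E ∧ ∀ v, v ∈ D ↔ v ∘ g ∈ E := by
  classical
  obtain ⟨φ, rfl⟩ := hD
  refine ⟨φ.freeVarFinset, fun g hg => ?_⟩
  choose f hf using hg
  refine ⟨_, ⟨φ.restrictFreeVar fun x => f x.1 x.2, rfl⟩, fun v => ?_⟩
  exact (BoundedFormula.realize_restrictFreeVar (v := v ∘ g) v
    (fun a => congrArg v (hf a.1 a.2))).symm

theorem exists_nat_support {D : Set (ℕ → U)} (hD : A.Definable L D) :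
    ∃ N₀, ∀ N, N₀ ≤ N → ∃ E : Set (Fin N → U), A.Definable L E ∧
      ∀ v : ℕ → U, v ∈ D ↔ (fun i : Fin N => v i) ∈ E := by
  obtain ⟨s, hs⟩ := exists_finset_support hD
  refine ⟨s.sup id + 1, fun N hN => hs (fun i : Fin N => (i : ℕ)) fun x hx => ?_⟩
  exact ⟨⟨x, (Nat.lt_succ_of_le (Finset.le_sup (f := id) hx)).trans_le hN⟩, rfl⟩

theorem exists_nat_prod_support {n : ℕ} {D : Set (ℕ × Fin n → U)} (hD : A.Definable L D) :
    ∃ N₀, ∀ N, N₀ ≤ N → ∃ E : Set (Fin N × Fin n → U), A.Definable L E ∧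
      ∀ v : ℕ × Fin n → U, v ∈ D ↔ (fun i : Fin N × Fin n => v (i.1, i.2)) ∈ E := by
  obtain ⟨s, hs⟩ := exists_finset_support hD
  refine ⟨s.sup Prod.fst + 1,
    fun N hN => hs (fun i : Fin N × Fin n => ((i.1 : ℕ), i.2)) fun x hx => ?_⟩
  exact ⟨(⟨x.1, (Nat.lt_succ_of_le (Finset.le_sup (f := Prod.fst) hx)).trans_le hN⟩, x.2), rfl⟩

end Definable

/-- Course-of-values recursion: by `hP`, the condition on term `i` sees only earlier terms, so the
rest of the history may be filled with a default. -/
theorem exists_seq_of_forall_exists {X : Type*} [Nonempty X] (P : ℕ → (ℕ → X) → X → Prop)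
    (hP : ∀ i f g x, (∀ j < i, f j = g j) → P i f x → P i g x) (h : ∀ i f, ∃ x, P i f x) :
    ∃ f : ℕ → X, ∀ i, P i f (f i) := by
  classical
  choose next hnext using h
  let x₀ : X := Classical.arbitrary X
  let f : ℕ → X := WellFounded.fix (C := fun _ => X) Nat.lt_wfRel.wf
    fun i rec => next i fun j => if hj : j < i then rec j hj else x₀
  have hf : ∀ i, f i = next i fun j => if j < i then f j else x₀ := fun i => by
    simpa using WellFounded.fix_eq (C := fun _ => X) Nat.lt_wfRel.wf
      (fun i rec => next i fun j => if hj : j < i then rec j hj else x₀) i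
  refine ⟨f, fun i => ?_⟩
  refine hP i (fun j => if j < i then f j else x₀) f _ (fun j hj => if_pos hj) ?_
  rw [hf i]
  exact hnext i _

theorem mk_union_range_lt {κ : Cardinal.{w}} {A : Set U} (hκ : ℵ₀ < κ) (hA : #A < κ) {β : Type} [Countable β] (b : β → U) :
    #(A ∪ Set.range b : Set U) < κ :=
  (mk_union_le _ _).trans_lt (add_lt_of_lt hκ.le hA
    ((Set.countable_range b).le_aleph0.trans_lt hκ))

/-! ### Saturation for countably many variables -/

section Saturation

variable [Nonempty U] {κ : Cardinal.{w}} {A : Set U} {ι : Type*} [Nonempty ι]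

theorem IsSaturated.exists_mem_one (hU : IsSaturated L U κ) (hA : #A < κ)
    {F : ι → Set (Fin 1 → U)} (hd : Directed (· ⊇ ·) F) (hF : ∀ i, A.Definable L (F i))
    (hne : ∀ i, (F i).Nonempty) : ∃ x, ∀ i, x ∈ F i := by
  choose φ hφ using hF
  let K : ι → Set (TypeOver L A 1) := fun i =>
    Theory.typesWith (L[[A]].completeTheory U) (Formula.equivSentence (φ i))
  have hK : ∀ i (a : Fin 1 → U), tp L A a ∈ K i ↔ a ∈ F i := fun i a => by
    rw [hφ i]
    exact Theory.CompleteType.formula_mem_typeOf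
  obtain ⟨q, hq⟩ := IsCompact.nonempty_iInter_of_directed_nonempty_isCompact_isClosed K
    (fun i j => by
      obtain ⟨k, hi, hj⟩ := hd i j
      refine ⟨k, fun q hq => ?_, fun q hq => ?_⟩ <;> obtain ⟨a, rfl⟩ := hU A hA q <;>
        rw [hK] at hq ⊢
      exacts [hi hq, hj hq])
    (fun i => (hne i).elim fun a ha => ⟨tp L A a, (hK i a).2 ha⟩)
    (fun i => (CompleteType.isClosed_typesWith _).isCompact)
    (fun i => CompleteType.isClosed_typesWith _)
  obtain ⟨a, rfl⟩ := hU A hA q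
  exact ⟨a, fun i => (hK i a).1 (Set.mem_iInter.1 hq i)⟩

/-- Coordinates are chosen one at a time, keeping every `F i` compatible with the prefix. The
possible next values form a directed family of projections, definable over `A` and the finite
prefix. -/
theorem IsSaturated.exists_mem_nat (hU : IsSaturated L U κ) (hκ : ℵ₀ < κ) (hA : #A < κ)
    {F : ι → Set (ℕ → U)} (hd : Directed (· ⊇ ·) F) (hF : ∀ i, A.Definable L (F i))
    (hne : ∀ i, (F i).Nonempty) : ∃ x, ∀ i, x ∈ F i := by
  obtain ⟨f, hf⟩ := exists_seq_of_forall_exists (X := U)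
    -- Compatibility of the prefix is an antecedent because the recursion must provide a next value
    -- for every `f`.
    (fun k f x => (∀ i, ∃ v ∈ F i, ∀ j < k, v j = f j) →
      ∀ i, ∃ v ∈ F i, (∀ j < k, v j = f j) ∧ v k = x)
    (fun k f g x hfg h hg i => by
      obtain ⟨v, hv, h1, h2⟩ := h (fun i => (hg i).imp fun v hv =>
        ⟨hv.1, fun j hj => (hv.2 j hj).trans (hfg j hj).symm⟩) i
      exact ⟨v, hv, fun j hj => (h1 j hj).trans (hfg j hj), h2⟩)
    (fun k f => by
      by_cases hg : ∀ i, ∃ v ∈ F i, ∀ j < k, v j = f j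
      swap
      · exact ⟨Classical.arbitrary U, fun h => absurd h hg⟩
      let b : Fin k → U := fun j => f j
      obtain ⟨x, hx⟩ := hU.exists_mem_one (mk_union_range_lt hκ hA b)
        (F := fun i => {x : Fin 1 → U | ∃ v ∈ F i, (∀ j < k, v j = f j) ∧ v k = x 0})
        (fun i j => by
          obtain ⟨l, hi, hj⟩ := hd i j
          exact ⟨l, fun x ⟨v, hv, h⟩ => ⟨v, hi hv, h⟩, fun x ⟨v, hv, h⟩ => ⟨v, hj hv, h⟩⟩)
        (fun i => by
          obtain ⟨N₀, hN⟩ := exists_nat_support (hF i)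
          obtain ⟨E, hE, hEF⟩ := hN (max N₀ (k + 1)) (le_max_left _ _)
          have hkN : k < max N₀ (k + 1) := Nat.lt_of_succ_le (le_max_right _ _)
          have := definable_fiber (hE.image_comp (Sum.elim (fun _ : Fin 1 => ⟨k, hkN⟩)
            fun j : Fin k => ⟨j, j.2.trans hkN⟩)) b
          convert this using 1
          ext x
          constructor
          · rintro ⟨v, hv, h1, h2⟩
            refine ⟨_, (hEF v).1 hv, ?_⟩
            funext z
            rcases z with z | z
            · simp [h2, Subsingleton.elim z 0]
            · simp [h1, b]
          · rintro ⟨w, hw, hx⟩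
            let v : ℕ → U := fun j => if h : j < max N₀ (k + 1) then w ⟨j, h⟩ else f 0
            have hv : ∀ j (h : j < max N₀ (k + 1)), v j = w ⟨j, h⟩ := fun j h => dif_pos h
            refine ⟨v, (hEF v).2 ?_, fun j hj => ?_, ?_⟩
            · convert hw using 1
              funext j
              exact hv j j.2
            · rw [hv j (hj.trans hkN)]
              exact congrFun hx (Sum.inr ⟨j, hj⟩)
            · rw [hv k hkN]
              exact congrFun hx (Sum.inl 0))
        (fun i => by
          obtain ⟨v, hv, h⟩ := hg i
          exact ⟨fun _ => v k, v, hv, h, rfl⟩)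
      exact ⟨x 0, fun _ i => hx i⟩)
  have good : ∀ k i, ∃ v ∈ F i, ∀ j < k, v j = f j := by
    intro k
    induction k with
    | zero => exact fun i => (hne i).imp fun v hv => ⟨hv, by simp⟩
    | succ k ih =>
      intro i
      obtain ⟨v, hv, h1, h2⟩ := hf k ih i
      refine ⟨v, hv, fun j hj => ?_⟩
      rcases (Nat.lt_succ_iff_lt_or_eq.1 hj) with h | rfl
      exacts [h1 j h, h2]
  refine ⟨f, fun i => ?_⟩
  obtain ⟨N, hN⟩ := exists_nat_support (hF i)
  obtain ⟨E, -, hE⟩ := hN N le_rfl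
  obtain ⟨v, hv, h⟩ := good N i
  rw [hE] at hv ⊢
  convert hv using 1
  funext j
  exact (h j j.2).symm

theorem IsSaturated.exists_mem (hU : IsSaturated L U κ) (hκ : ℵ₀ < κ) (hA : #A < κ)
    {α : Type} [Countable α] {F : ι → Set (α → U)} (hd : Directed (· ⊇ ·) F)
    (hF : ∀ i, A.Definable L (F i)) (hne : ∀ i, (F i).Nonempty) : ∃ x, ∀ i, x ∈ F i := by
  obtain ⟨e, he⟩ := exists_injective_nat α
  obtain ⟨x, hx⟩ := hU.exists_mem_nat hκ hA (F := fun i => {v : ℕ → U | v ∘ e ∈ F i})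
    (fun i j => (hd i j).imp fun k hk => ⟨fun v hv => hk.1 hv, fun v hv => hk.2 hv⟩)
    (fun i => (hF i).preimage_comp e)
    (fun i => by
      obtain ⟨v, hv⟩ := hne i
      refine ⟨Function.extend e v fun _ => Classical.arbitrary U, ?_⟩
      have hev : Function.extend e v (fun _ => Classical.arbitrary U) ∘ e = v :=
        funext fun j => he.extend_apply v _ j
      change _ ∈ F i
      rwa [hev])
  exact ⟨x ∘ e, hx⟩

end Saturation

/-- The tuples `b` and `b'` belong to the same `A`-definable sets. -/
def SameType (L : FirstOrder.Language.{u, v}) {U : Type w} [L.Structure U] (A : Set U) {β : Type}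
    (b b' : β → U) : Prop :=
  ∀ D : Set (β → U), A.Definable L D → (b ∈ D ↔ b' ∈ D)

theorem sameType_of_imp {A : Set U} {β : Type} {b b' : β → U}
    (h : ∀ D : Set (β → U), A.Definable L D → b ∈ D → b' ∈ D) : SameType L A b b' :=
  fun D hD => ⟨h D hD, fun hb' => by_contra fun hb => h _ hD.compl hb hb'⟩

theorem SameType.comp {A : Set U} {β γ : Type} {b b' : β → U} (h : SameType L A b b') (f : γ → β) :
    SameType L A (b ∘ f) (b' ∘ f) :=
  fun _ hD => h _ (hD.preimage_comp f)

/-- A formula with arbitrarily many parameter variables uses only finitely many of them. -/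
theorem exists_finite_params {P α : Type*} (φ : L.Formula (P ⊕ α)) :
    ∃ (m : ℕ) (χ : L.Formula (α ⊕ Fin m)) (h : Fin m → P), ∀ (a : α → U) (c : P → U),
      χ.Realize (Sum.elim a (c ∘ h)) ↔ φ.Realize (Sum.elim c a) := by
  classical
  let t : Finset P := φ.freeVarFinset.preimage Sum.inl Sum.inl_injective.injOn
  let e := t.equivFin
  let f : φ.freeVarFinset → α ⊕ Fin t.card := fun x => match x with
    | ⟨Sum.inl c, hx⟩ => Sum.inr (e ⟨c, Finset.mem_preimage.2 hx⟩)
    | ⟨Sum.inr i, _⟩ => Sum.inl i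
  refine ⟨t.card, φ.restrictFreeVar f, fun k => (e.symm k).1, fun a c => ?_⟩
  refine BoundedFormula.realize_restrictFreeVar _ ?_
  rintro ⟨x | i, hx⟩ <;> simp [f]

theorem exists_instantiate {n : ℕ} (ψ : L[[U]].Formula (Fin n)) :
    ∃ (m : ℕ) (φ : L.Formula (Fin n ⊕ Fin m)) (b : Fin m → U),
      ∀ a, ψ.Realize a ↔ φ.Realize (Sum.elim a b) := by
  obtain ⟨m, φ, h, hφ⟩ := exists_finite_params (U := U)
    (BoundedFormula.constantsVarsEquiv ψ : L.Formula (U ⊕ Fin n))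
  refine ⟨m, φ, (fun a => (L.con a : U)) ∘ h, fun a => ?_⟩
  exact (BoundedFormula.realize_constantsVarsEquiv (φ := ψ) (v := a) (xs := default)).symm.trans
    (hφ a _).symm

/-! ### Invariance and the type of a Morley sequence -/

section Invariant

variable [Nonempty U] {n : ℕ} {p : GlobalType L U n} {A : Set U}

/-- The finitely many parameters used, from `A` and from `b`, are merged into one tuple `c b`; those
from `A` stay fixed, so `c b` and `c b'` have the same type over `A`. -/
theorem IsInvariantOver.large_fiber_iff (hp : IsInvariantOver p A) {β : Type}
    {D : Set (Fin n ⊕ β → U)} (hD : A.Definable L D) {b b' : β → U} (hb : SameType L A b b') :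
    Large p {x | Sum.elim x b ∈ D} ↔ Large p {x | Sum.elim x b' ∈ D} := by
  obtain ⟨φ, rfl⟩ := Set.definable_iff_exists_formula_sum.1 hD
  obtain ⟨m, χ, h, hχ⟩ := exists_finite_params (U := U)
    (φ.relabel (Sum.elim (Sum.inl ∘ Sum.inl) (Sum.elim Sum.inr (Sum.inl ∘ Sum.inr)) :
      A ⊕ (Fin n ⊕ β) → (A ⊕ β) ⊕ Fin n))
  let c : (β → U) → Fin m → U := fun b => Sum.elim (Subtype.val : A → U) b ∘ h
  have hc : ∀ (b : β → U) (a : Fin n → U), (instantiate χ (c b)).Realize a ↔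
      a ∈ {x | Sum.elim x b ∈ {v | φ.Realize (Sum.elim (Subtype.val : A → U) v)}} := by
    intro b a
    rw [realize_instantiate, hχ, Formula.realize_relabel]
    refine iff_of_eq (congrArg _ ?_)
    funext x
    rcases x with x | x | x <;> rfl
  rw [large_iff_holds (hc b), large_iff_holds (hc b')]
  refine hp _ χ (c b) (c b') (SetLike.ext fun ψ => ?_)
  rw [Theory.CompleteType.mem_typeOf, Theory.CompleteType.mem_typeOf]
  exact hb _ (definable_preimage_params
    (E := {v | (Formula.equivSentence.symm ψ : L[[A]].Formula (Fin m)).Realize v}) ⟨_, rfl⟩ h)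

/-- The tuple `a_0, …, a_{k-1}` of coordinates. -/
def initialTuple (k : ℕ) (a : ℕ → Fin n → U) : Fin k × Fin n → U := fun z => a z.1 z.2

omit [Nonempty U] in
theorem iUnion_range_eq (a : ℕ → Fin n → U) (i : ℕ) :
    ⋃ j < i, Set.range (a j) = Set.range (initialTuple i a) := by
  ext x
  simp only [Set.mem_iUnion, Set.mem_range]
  constructor
  · rintro ⟨j, hj, k, rfl⟩
    exact ⟨(⟨j, hj⟩, k), rfl⟩
  · rintro ⟨⟨j, k⟩, rfl⟩
    exact ⟨j, j.2, k, rfl⟩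

/-- Appends the `n`-tuple in the left summand as the last block. -/
def lastBlock (n k : ℕ) : Fin (k + 1) × Fin n → Fin n ⊕ (Fin k × Fin n) := fun z =>
  Fin.lastCases (motive := fun _ => Fin n ⊕ (Fin k × Fin n)) (Sum.inl z.2)
    (fun j => Sum.inr (j, z.2)) z.1

omit [Nonempty U] in
theorem elim_comp_lastBlock (k : ℕ) (a : ℕ → Fin n → U) :
    Sum.elim (a k) (initialTuple k a) ∘ lastBlock n k = initialTuple (k + 1) a := by
  funext ⟨j, l⟩
  refine Fin.lastCases ?_ (fun j => ?_) j <;> simp [lastBlock, initialTuple]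

theorem IsMorleySequence.mem_fiber_iff {a : ℕ → Fin n → U} (ha : IsMorleySequence p A a) (i : ℕ)
    {E : Set (Fin n ⊕ (Fin i × Fin n) → U)} (hE : A.Definable L E) :
    Sum.elim (a i) (initialTuple i a) ∈ E ↔ Large p {x | Sum.elim x (initialTuple i a) ∈ E} := by
  have h := ha i
  rw [iUnion_range_eq] at h
  exact h.mem_iff (definable_fiber hE _)

theorem IsMorleySequence.sameType_initialTuple (hp : IsInvariantOver p A) {a a' : ℕ → Fin n → U}
    (ha : IsMorleySequence p A a) (ha' : IsMorleySequence p A a') (k : ℕ) :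
    SameType L A (initialTuple k a) (initialTuple k a') := by
  induction k with
  | zero => exact fun D _ => by rw [Subsingleton.elim (initialTuple 0 a) (initialTuple 0 a')]
  | succ k ih =>
    intro D hD
    have hE := hD.preimage_comp (lastBlock n k)
    rw [← elim_comp_lastBlock, ← elim_comp_lastBlock]
    exact (ha.mem_fiber_iff k hE).trans
      ((hp.large_fiber_iff hE ih).trans (ha'.mem_fiber_iff k hE).symm)

/-- By invariance, being a Morley sequence over `A` depends only on the type of the sequence over
`A`; this lets compactness produce Morley sequences. -/
theorem IsMorleySequence.of_sameType (hp : IsInvariantOver p A) {a a' : ℕ → Fin n → U}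
    (ha : IsMorleySequence p A a)
    (h : ∀ k, SameType L A (initialTuple k a) (initialTuple k a')) : IsMorleySequence p A a' := by
  intro i
  rw [iUnion_range_eq, realizesRestriction_iff]
  intro D hD hDp
  obtain ⟨E, hE, hDE⟩ := exists_definable_fiber hD
  rw [show D = {x | Sum.elim x (initialTuple i a') ∈ E} from Set.ext hDE,
    ← hp.large_fiber_iff hE (h i), ← ha.mem_fiber_iff i hE] at hDp
  rw [hDE]
  obtain ⟨g, hg⟩ : ∃ g : Fin n ⊕ (Fin i × Fin n) → Fin (i + 1) × Fin n,
      ∀ a : ℕ → Fin n → U, Sum.elim (a i) (initialTuple i a) = initialTuple (i + 1) a ∘ g :=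
    ⟨Sum.elim (fun l => (Fin.last i, l)) fun z => (z.1.castSucc, z.2), fun a => by
      funext z
      rcases z with z | z <;> rfl⟩
  rw [hg] at hDp ⊢
  exact ((h (i + 1)).comp g E hE).1 hDp

end Invariant

/-! ### Existence of Morley sequences -/

section Existence

variable [Nonempty U] {n : ℕ} {κ : Cardinal.{w}} {A : Set U}

theorem IsSaturated.exists_realizesRestriction (hU : IsSaturated L U κ) (hκ : ℵ₀ < κ) (hA : #A < κ)
    (p : GlobalType L U n) : ∃ a, RealizesRestriction p A a := by
  have : Nonempty {D : Set (Fin n → U) // A.Definable L D ∧ Large p D} :=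
    ⟨⟨Set.univ, Set.definable_univ, large_univ⟩⟩
  obtain ⟨a, ha⟩ := hU.exists_mem hκ hA
    (F := fun D : {D : Set (Fin n → U) // A.Definable L D ∧ Large p D} => D.1)
    (fun D E => ⟨⟨D.1 ∩ E.1, D.2.1.inter E.2.1, D.2.2.inter E.2.2⟩, Set.inter_subset_left,
      Set.inter_subset_right⟩)
    (fun D => D.2.1) (fun D => D.2.2.nonempty)
  exact ⟨a, realizesRestriction_iff.2 fun D hD hp => ha ⟨D, hD, hp⟩⟩

theorem IsSaturated.exists_isMorleySequence (hU : IsSaturated L U κ) (hκ : ℵ₀ < κ) (hA : #A < κ)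
    (p : GlobalType L U n) : ∃ a, IsMorleySequence p A a := by
  refine exists_seq_of_forall_exists
    (fun i a x => RealizesRestriction p (A ∪ ⋃ j < i, Set.range (a j)) x) ?_ ?_
  · intro i f g x hfg h
    rwa [show ⋃ j < i, Set.range (g j) = ⋃ j < i, Set.range (f j) from
      Set.iUnion₂_congr fun j hj => (by rw [hfg j hj])]
  · intro i f
    simp only [iUnion_range_eq]
    exact hU.exists_realizesRestriction hκ (mk_union_range_lt hκ hA _) p

end Existence

/-! ### Separation, definability of the type, and the sequence in `M` -/

section Stable

variable [Nonempty U] {n : ℕ} {κ : Cardinal.{w}} {A : Set U} {p : GlobalType L U n}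

/-- Generic stability yields, for every definable relation `D(x, y)`, a formula of the type of a
finite Morley sequence such that no `b` is `D`-related to all entries of one solution and to no
entry of another one. -/
theorem exists_separating (hU : IsSaturated L U κ) (hκ : ℵ₀ < κ) (hA : #A < κ)
    (hp : IsInvariantOver p A)
    (hlim : ∀ a : ℕ → Fin n → U, IsMorleySequence p A a →
      Tendsto (fun i => globalTp L (a i)) atTop (𝓝 p))
    {a : ℕ → Fin n → U} (ha : IsMorleySequence p A a) {β : Type} [Countable β]
    {D : Set (Fin n ⊕ β → U)} (hD : A.Definable L D) :
    ∃ (N : ℕ) (Θ : Set (Fin N × Fin n → U)), A.Definable L Θ ∧ initialTuple N a ∈ Θ ∧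
      ∀ z ∈ Θ, ∀ z' ∈ Θ, ∀ b : β → U, (∀ i, Sum.elim (fun l => z (i, l)) b ∉ D) →
        ¬ ∀ i, Sum.elim (fun l => z' (i, l)) b ∈ D := by
  by_contra! hcon
  let ι := ℕ × {Θ : Set (ℕ × Fin n → U) // A.Definable L Θ ∧ Function.uncurry a ∈ Θ}
  have : Nonempty ι := ⟨(0, ⟨Set.univ, Set.definable_univ, trivial⟩)⟩
  let α := (ℕ × Fin n) ⊕ ((ℕ × Fin n) ⊕ β)
  let x : ℕ → Fin n ⊕ β → α := fun i =>
    Sum.elim (fun l => Sum.inl (i, l)) fun j => Sum.inr (Sum.inr j)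
  let x' : ℕ → Fin n ⊕ β → α := fun i =>
    Sum.elim (fun l => Sum.inr (Sum.inl (i, l))) fun j => Sum.inr (Sum.inr j)
  -- A point of all these sets codes two sequences with the type of `a` and a common `b`, with `D`
  -- false along the first and true along the second.
  obtain ⟨w, hw⟩ := hU.exists_mem hκ hA
    (F := fun t : ι => {w : α → U | (w ∘ Sum.inl ∈ t.2.1 ∧ w ∘ Sum.inr ∘ Sum.inl ∈ t.2.1) ∧
      ∀ i : Fin t.1, w ∘ x i ∉ D ∧ w ∘ x' i ∈ D})
    (fun s t => ⟨(max s.1 t.1, ⟨s.2.1 ∩ t.2.1, s.2.2.1.inter t.2.2.1, s.2.2.2, t.2.2.2⟩),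
      fun w hw => ⟨⟨hw.1.1.1, hw.1.2.1⟩,
        fun i => hw.2 ⟨i, i.2.trans_le (le_max_left _ _)⟩⟩,
      fun w hw => ⟨⟨hw.1.1.2, hw.1.2.2⟩,
        fun i => hw.2 ⟨i, i.2.trans_le (le_max_right _ _)⟩⟩⟩)
    (fun t => by
      refine ((t.2.2.1.preimage_comp _).inter (t.2.2.1.preimage_comp _)).inter ?_
      have h : A.Definable L (⋂ i : Fin t.1, {w : α → U | w ∘ x i ∉ D ∧ w ∘ x' i ∈ D}) :=
        Set.definable_iInter_of_finite fun i =>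
          (hD.preimage_comp (x i)).compl.inter (hD.preimage_comp (x' i))
      rw [← Set.ofPred_forall] at h
      exact h)
    (fun t => by
      obtain ⟨N₀, hN⟩ := exists_nat_prod_support t.2.2.1
      obtain ⟨E, hE, hEt⟩ := hN (max N₀ t.1) (le_max_left _ _)
      obtain ⟨z, hz, z', hz', b, h, h'⟩ := hcon _ E hE ((hEt _).1 t.2.2.2)
      let ext : (Fin (max N₀ t.1) × Fin n → U) → ℕ × Fin n → U := fun z i =>
        if h : i.1 < max N₀ t.1 then z (⟨i.1, h⟩, i.2) else Classical.arbitrary U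
      have hext : ∀ z (i : Fin (max N₀ t.1)) l, ext z (i, l) = z (i, l) :=
        fun z i l => dif_pos i.2
      have hmem : ∀ z ∈ E, ext z ∈ t.2.1 := fun z hz => by
        rw [hEt]
        convert hz using 1
        funext i
        exact hext z i.1 i.2
      refine ⟨Sum.elim (ext z) (Sum.elim (ext z') b), ⟨hmem z hz, hmem z' hz'⟩, fun i => ?_⟩
      have hi := i.2.trans_le (le_max_right N₀ t.1)
      constructor
      · convert h ⟨i, hi⟩ using 2
        funext l
        rcases l with l | l
        exacts [hext z ⟨i, hi⟩ l, rfl]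
      · convert h' ⟨i, hi⟩ using 1
        funext l
        rcases l with l | l
        exacts [hext z' ⟨i, hi⟩ l, rfl])
  let b : β → U := fun j => w (Sum.inr (Sum.inr j))
  let v : ℕ → Fin n → U := fun i l => w (Sum.inl (i, l))
  let v' : ℕ → Fin n → U := fun i l => w (Sum.inr (Sum.inl (i, l)))
  have hv : IsMorleySequence p A v := ha.of_sameType hp fun k =>
    (sameType_of_imp (b := Function.uncurry a) (b' := w ∘ Sum.inl)
      fun Θ hΘ h => (hw (0, ⟨Θ, hΘ, h⟩)).1.1).comp fun z : Fin k × Fin n => ((z.1 : ℕ), z.2)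
  have hv' : IsMorleySequence p A v' := ha.of_sameType hp fun k =>
    (sameType_of_imp (b := Function.uncurry a) (b' := w ∘ Sum.inr ∘ Sum.inl)
      fun Θ hΘ h => (hw (0, ⟨Θ, hΘ, h⟩)).1.2).comp fun z : Fin k × Fin n => ((z.1 : ℕ), z.2)
  have hvD : ∀ i, Sum.elim (v i) b ∉ D ∧ Sum.elim (v' i) b ∈ D := fun i => by
    have h := (hw (i + 1, ⟨Set.univ, Set.definable_univ, trivial⟩)).2 ⟨i, Nat.lt_succ_self i⟩
    constructor
    · convert h.1 using 2
      funext l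
      rcases l with l | l <;> rfl
    · convert h.2 using 1
      funext l
      rcases l with l | l <;> rfl
  by_cases hDb : Large p {x | Sum.elim x b ∈ D}
  · obtain ⟨i, hi⟩ := (eventually_mem_of_tendsto (hlim v hv) hDb).exists
    exact (hvD i).1 hi
  · rw [← large_compl (definable_fiber hD b)] at hDb
    obtain ⟨i, hi⟩ := (eventually_mem_of_tendsto (hlim v' hv') hDb).exists
    exact hi (hvD i).2

/-- The defining condition is that some element of the separating `Θ` has all its entries
`D`-related to `b`. A Morley sequence over `A` and `b` is such a witness if the fiber is large;
otherwise it avoids the fiber, and separation excludes any witness. -/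
theorem definable_setOf_large (hU : IsSaturated L U κ) (hκ : ℵ₀ < κ) (hA : #A < κ)
    (hp : IsInvariantOver p A)
    (hlim : ∀ a : ℕ → Fin n → U, IsMorleySequence p A a →
      Tendsto (fun i => globalTp L (a i)) atTop (𝓝 p))
    {β : Type} [Finite β] {D : Set (Fin n ⊕ β → U)} (hD : A.Definable L D) :
    A.Definable L {b : β → U | Large p {x | Sum.elim x b ∈ D}} := by
  obtain ⟨a, ha⟩ := hU.exists_isMorleySequence hκ hA p
  obtain ⟨N, Θ, hΘ, haΘ, hsep⟩ := exists_separating hU hκ hA hp hlim ha hD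
  let x : Fin N → Fin n ⊕ β → (Fin N × Fin n) ⊕ β := fun i =>
    Sum.elim (fun l => Sum.inl (i, l)) Sum.inr
  have hdef := ((hΘ.preimage_comp (Sum.inl : _ → (Fin N × Fin n) ⊕ β)).inter
    (Set.definable_iInter_of_finite fun i => hD.preimage_comp (x i))).image_comp
      (Sum.inr : β → _)
  convert hdef using 1
  ext b
  obtain ⟨a', ha'⟩ := hU.exists_isMorleySequence hκ (mk_union_range_lt hκ hA b) p
  have ha'Θ : initialTuple N a' ∈ Θ := (ha.sameType_initialTuple hp
    (ha'.mono Set.subset_union_left) N Θ hΘ).1 haΘ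
  have hmem : ∀ i, Sum.elim (a' i) b ∈ D ↔ Large p {x | Sum.elim x b ∈ D} := fun i =>
    ((ha' i).mono Set.subset_union_left).mem_iff (definable_fiber hD b)
  constructor
  · intro hb
    refine ⟨Sum.elim (initialTuple N a') b, ⟨ha'Θ, Set.mem_iInter.2 fun i => ?_⟩, rfl⟩
    convert (hmem i).2 hb using 1
    change _ ∘ _ ∈ D ↔ _
    refine iff_of_eq (congrArg (· ∈ D) ?_)
    funext l
    rcases l with l | l <;> rfl
  · rintro ⟨w, ⟨hw, hwD⟩, rfl⟩
    by_contra hb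
    refine hsep _ ha'Θ _ hw _ (fun i h => hb ((hmem i).1 h)) fun i => ?_
    have h := Set.mem_iInter.1 hwD i
    change _ ∘ _ ∈ D at h
    convert h using 1
    funext l
    rcases l with l | l <;> rfl

/-- Built downwards from `Θ`: level `j` collects the tuples that `p`-most `x` extend into level `j +
1`. Levels above `N` are irrelevant. -/
theorem IsMorleySequence.exists_tower
    (hdef : ∀ (k : ℕ) (E : Set (Fin n ⊕ (Fin k × Fin n) → U)), A.Definable L E →
      A.Definable L {b | Large p {x | Sum.elim x b ∈ E}})
    {a : ℕ → Fin n → U} (ha : IsMorleySequence p A a) (N : ℕ) {Θ : Set (Fin N × Fin n → U)}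
    (hΘ : A.Definable L Θ) (haΘ : initialTuple N a ∈ Θ) :
    ∃ Ψ : ∀ j, Set (Fin j × Fin n → U), (∀ j, A.Definable L (Ψ j)) ∧ Ψ N = Θ ∧
      (∀ j < N, ∀ z ∈ Ψ j, Large p {x | Sum.elim x z ∘ lastBlock n j ∈ Ψ (j + 1)}) ∧
      initialTuple 0 a ∈ Ψ 0 := by
  classical
  induction N with
  | zero =>
    refine ⟨Function.update (fun _ => Set.univ) 0 Θ, fun j => ?_, by simp, by simp, by simpa⟩
    rcases eq_or_ne j 0 with rfl | hj
    · simpa using hΘ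
    · simp [hj]
  | succ N ih =>
    have hE := hΘ.preimage_comp (lastBlock n N)
    rw [← elim_comp_lastBlock] at haΘ
    obtain ⟨Ψ, h1, h2, h3, h4⟩ := ih (hdef N _ hE) ((ha.mem_fiber_iff N hE).1 haΘ)
    refine ⟨Function.update Ψ (N + 1) Θ, fun j => ?_, by simp, fun j hj z hz => ?_, by simpa⟩
    · rcases eq_or_ne j (N + 1) with rfl | hj
      · simpa using hΘ
      · simpa [hj] using h1 j
    · rw [Function.update_of_ne hj.ne] at hz
      rcases Nat.lt_succ_iff_lt_or_eq.1 hj with h | rfl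
      · rw [Function.update_of_ne (by omega)]
        exact h3 j h z hz
      · rw [Function.update_self]
        rw [h2] at hz
        exact hz

omit [Nonempty U] in
theorem exists_mem_elementarySubstructure (M : L.ElementarySubstructure U)
    {D : Set (Fin n → U)} (hD : (M : Set U).Definable L D) (hne : D.Nonempty) :
    ∃ x : Fin n → M, (fun k => (x k : U)) ∈ D := by
  obtain ⟨φ, rfl⟩ := Set.definable_iff_exists_formula_sum.1 hD
  obtain ⟨y, hy⟩ := hne
  have h : (Formula.iExs (Fin n) φ).Realize (M.subtype ∘ id) := Formula.realize_iExs.2 ⟨y, hy⟩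
  rw [M.subtype.map_formula, Formula.realize_iExs] at h
  obtain ⟨x, hx⟩ := h
  refine ⟨x, ?_⟩
  convert (M.subtype.map_formula φ _).2 hx using 1
  refine iff_of_eq (congrArg (fun v : (M : Set U) ⊕ Fin n → U => φ.Realize v) ?_)
  funext i
  cases i <;> rfl

/-- A sequence in `M` whose increasing subsequences satisfy countably many prescribed conditions
on Morley sequences. -/
theorem exists_seq_mem_tower (M : L.ElementarySubstructure U) (N : ℕ → ℕ)
    (Ψ : ℕ → ∀ j, Set (Fin j × Fin n → U)) (hΨ : ∀ t j, (M : Set U).Definable L (Ψ t j))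
    (hlarge : ∀ t, ∀ j < N t, ∀ z ∈ Ψ t j,
      Large p {x | Sum.elim x z ∘ lastBlock n j ∈ Ψ t (j + 1)})
    (h0 : ∀ t z, z ∈ Ψ t 0) :
    ∃ c : ℕ → Fin n → U, (∀ i k, c i k ∈ M) ∧ ∀ t, ∀ σ : ℕ → ℕ, StrictMono σ → t ≤ σ 0 →
      initialTuple (N t) (c ∘ σ) ∈ Ψ t (N t) := by
  obtain ⟨x₀, -⟩ := exists_mem_elementarySubstructure (n := n) M Set.definable_univ
    Set.univ_nonempty
  have : Nonempty (Fin n → M) := ⟨x₀⟩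
  obtain ⟨c, hc⟩ := exists_seq_of_forall_exists (X := Fin n → M)
    -- The bound `t ≤ i` leaves finitely many conditions at stage `i`; `σ` need not be increasing.
    (fun i f x => ∀ t ≤ i, ∀ j < N t, ∀ σ : Fin j → Fin i,
      (fun z : Fin j × Fin n => (f (σ z.1) z.2 : U)) ∈ Ψ t j →
      Sum.elim (fun k => (x k : U)) (fun z : Fin j × Fin n => (f (σ z.1) z.2 : U)) ∘
        lastBlock n j ∈ Ψ t (j + 1))
    (fun i f g x hfg h t ht j hj σ => by
      have := h t ht j hj σ
      simpa only [hfg _ (σ _).2] using this)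
    (fun i f => by
      let I := Σ t : Fin (i + 1), Σ j : Fin (N t), Fin j → Fin i
      let z : ∀ s : I, Fin s.2.1 × Fin n → U := fun s z => f (s.2.2 z.1) z.2
      let S : I → Set (Fin n → U) := fun s => {x | z s ∈ Ψ s.1 s.2.1 →
        Sum.elim x (z s) ∘ lastBlock n s.2.1 ∈ Ψ s.1 (s.2.1 + 1)}
      have hS : ∀ s, (M : Set U).Definable L (S s) ∧ Large p (S s) := fun s => by
        by_cases hz : z s ∈ Ψ s.1 s.2.1
        · simp only [S, hz, true_imp_iff]
          refine ⟨?_, hlarge _ _ s.2.1.2 _ hz⟩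
          have := definable_fiber ((hΨ s.1 (s.2.1 + 1)).preimage_comp (lastBlock n s.2.1)) (z s)
          rwa [Set.union_eq_self_of_subset_right] at this
          rintro _ ⟨k, rfl⟩
          exact (f (s.2.2 k.1) k.2).2
        · simp only [S, hz, false_imp_iff]
          exact ⟨Set.definable_univ, large_univ⟩
      obtain ⟨x, hx⟩ := exists_mem_elementarySubstructure M
        (Set.definable_iInter_of_finite fun s => (hS s).1)
        (large_iInter fun s => (hS s).2).nonempty
      refine ⟨x, fun t ht j hj σ hσ => ?_⟩
      exact Set.mem_iInter.1 hx ⟨⟨t, Nat.lt_succ_of_le ht⟩, ⟨j, hj⟩, σ⟩ hσ)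
  refine ⟨fun i k => c i k, fun i k => (c i k).2, fun t σ hσ ht => ?_⟩
  have key : ∀ j ≤ N t, initialTuple j ((fun i k => (c i k : U)) ∘ σ) ∈ Ψ t j := by
    intro j
    induction j with
    | zero => exact fun _ => h0 t _
    | succ j ih =>
      intro hj
      rw [← elim_comp_lastBlock]
      exact hc (σ j) t (ht.trans (hσ.monotone (Nat.zero_le j))) j hj
        (fun l => ⟨σ l, hσ l.2⟩) (ih (Nat.le_of_succ_le hj))
  exact key _ le_rfl

end Stable

theorem IsGenericallyStableOver.isSeqApproximatedOver [Countable L.Symbols] [Nonempty U] {n : ℕ}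
    {κ : Cardinal.{w}} (hκ : ℵ₀ < κ) (hU : IsSaturated L U κ) {p : GlobalType L U n}
    {M : L.ElementarySubstructure U} (hM : #M < κ) (hp : IsGenericallyStableOver p M) :
    IsSeqApproximatedOver p M := by
  obtain ⟨hinv, hlim⟩ := hp
  obtain ⟨a, ha⟩ := hU.exists_isMorleySequence hκ hM p
  have : Nonempty (Σ m, L.Formula (Fin n ⊕ Fin m)) := ⟨⟨0, ⊥⟩⟩
  obtain ⟨F, hF⟩ := exists_surjective_nat (Σ m, L.Formula (Fin n ⊕ Fin m))
  have hD (t : ℕ) : (M : Set U).Definable L {v | (F t).2.Realize v} :=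
    (Set.empty_definable_iff.2 ⟨_, rfl⟩).mono (Set.empty_subset _)
  choose N Θ hΘ haΘ hsep using fun t => exists_separating hU hκ hM hinv hlim ha (hD t)
  choose Ψ hΨ hΨN hlarge h0 using fun t => ha.exists_tower
    (fun _ _ hE => definable_setOf_large hU hκ hM hinv hlim hE) (N t) (hΘ t) (haΘ t)
  obtain ⟨c, hcM, hc⟩ := exists_seq_mem_tower M N Ψ hΨ hlarge
    fun t z => by rw [Subsingleton.elim z (initialTuple 0 a)]; exact h0 t
  refine ⟨c, hcM, tendsto_globalTp_iff.2 fun ψ hψ => ?_⟩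
  by_contra hcon
  obtain ⟨m, φ, b, hφ⟩ := exists_instantiate ψ
  obtain ⟨t, ht⟩ := hF ⟨m, φ⟩
  -- Failures are extracted beyond index `t`, where the tower for `φ` is already in force.
  obtain ⟨σ, hσ, hσψ⟩ := extraction_of_frequently_atTop
    ((not_eventually.1 hcon).and_eventually (eventually_ge_atTop t))
  obtain ⟨a', ha'⟩ := hU.exists_isMorleySequence hκ (mk_union_range_lt hκ hM b) p
  have hcΘ := hc t σ hσ (hσψ 0).2
  rw [hΨN] at hcΘ
  have ha'Θ := (ha.sameType_initialTuple hinv (ha'.mono Set.subset_union_left) (N t) (Θ t)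
    (hΘ t)).1 (haΘ t)
  have hφD : (M : Set U).Definable L {v | φ.Realize v} :=
    (Set.empty_definable_iff.2 ⟨_, rfl⟩).mono (Set.empty_subset _)
  -- Quantifying over `b` allows rewriting `F t`, on which the length of `b` depends.
  have hsep' : ∀ b : Fin m → U, (∀ i : Fin (N t), ¬ φ.Realize (Sum.elim (c (σ i)) b)) →
      ¬ ∀ i : Fin (N t), φ.Realize (Sum.elim (a' i) b) := by
    have := hsep t _ hcΘ _ ha'Θ
    rw [ht] at this
    exact this
  refine hsep' b (fun i h => (hσψ i).1 ((hφ _).2 h)) fun i => ?_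
  exact (((ha' i).mono Set.subset_union_left).mem_iff (definable_fiber hφD b)).2
    ⟨ψ, hφ, hψ⟩

end GenStable

theorem mainTheorem1 {L : FirstOrder.Language.{u, v}} [Countable L.Symbols]
    (T : L.Theory) (_hT : T.IsComplete)
    {U : Type w} [L.Structure U] [Nonempty U] [U ⊨ T]
    (κ : Cardinal.{w}) (_hκ : ℵ₀ < κ) (_hU : GenStable.IsSaturated L U κ)
    (n : ℕ) (p : GenStable.GlobalType L U n) :
    (∀ M : L.ElementarySubstructure U, #M < κ →
      GenStable.IsGenericallyStableOver p M → GenStable.IsSeqApproximatedOver p M) ∧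
    (GenStable.IsGenericallyStable κ p → GenStable.IsSeqApproximated κ p) :=
  ⟨fun _ hM hp => hp.isSeqApproximatedOver _hκ _hU hM,
    fun ⟨M, hM, hp⟩ => ⟨M, hM, hp.isSeqApproximatedOver _hκ _hU hM⟩⟩
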